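/- Let $X, Y$ be finite-dimensional real normed spaces that are polyhedral, i.e. the closed unit ball of each has only finitely many extreme points, and let $T : X \to Y$ be a bijective bounded linear operator. For nonzero $x \in X$ let $J(x) = \{ f \in X^* : \|f\| = 1,\ f(x) = \|x\| \}$, and for an extreme point $f$ of the closed unit ball $B_{X^*}$ of the dual let $\mathrm{Sm}(f) = \{ x \in X \setminus \{0\} : J(x) = \{f\} \}$; similarly for $Y$. A pair $(x,y)$ is called parallel if $\|x + \lambda y\| = \|x\| + \|y\|$ for some $\lambda \in \mathbb{R}$ with $|\lambda| = 1$, and a TEA (triangle equality attaining) pair if $\|x + y\| = \|x\| + \|y\|$; $T$ preserves parallel (respectively TEA) pairs if $(Tx, Ty)$ is a parallel (respectively TEA) pair in $Y$ whenever $(x,y)$ is one in $X$. Then the following three conditions are equivalent: (i) $T$ preserves parallel pairs; (ii) $T$ preserves TEA pairs; (iii) for each extreme point $f$ of $B_{X^*}$ there exists a unique extreme point $g$ of $B_{Y^*}$ such that $T(\mathrm{Sm}(f)) \subset \mathrm{Sm}(g)$. -/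

import Mathlib

/-- The set `Ext B_{X*}` of extreme points of the closed unit ball of the dual space. -/
def dualExt (X : Type*) [NormedAddCommGroup X] [NormedSpace ℝ X] : Set (StrongDual ℝ X) :=
  (Metric.closedBall (0 : StrongDual ℝ X) 1).extremePoints ℝ

/-- A (finite-dimensional) real normed space is polyhedral if its closed unit ball has only
finitely many extreme points. -/
def IsPolyhedral (X : Type*) [NormedAddCommGroup X] [NormedSpace ℝ X] : Prop :=
  ((Metric.closedBall (0 : X) 1).extremePoints ℝ).Finite

section

variable {X Y : Type*} [NormedAddCommGroup X] [NormedSpace ℝ X]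
  [NormedAddCommGroup Y] [NormedSpace ℝ Y]

/-- The set `J(x)` of norm-one functionals supporting `x` (used for `x ≠ 0`). -/
def supportFunctionals (x : X) : Set (StrongDual ℝ X) :=
  {f | ‖f‖ = 1 ∧ f x = ‖x‖}

/-- `Sm(f)`: the smooth points, that is nonzero `x` with a unique supporting functional,
whose supporting functional is `f`. -/
def smoothSet (f : StrongDual ℝ X) : Set X :=
  {x | x ≠ 0 ∧ supportFunctionals x = {f}}

/-- `(x, y)` is a parallel pair. -/
def IsParallelPair (x y : X) : Prop :=
  ∃ c : ℝ, |c| = 1 ∧ ‖x + c • y‖ = ‖x‖ + ‖y‖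

/-- `(x, y)` is a triangle equality attaining (TEA) pair. -/
def IsTEAPair (x y : X) : Prop :=
  ‖x + y‖ = ‖x‖ + ‖y‖

/-- `T` preserves parallel pairs. -/
def PreservesParallelPairs (T : X →L[ℝ] Y) : Prop :=
  ∀ x y : X, IsParallelPair x y → IsParallelPair (T x) (T y)

/-- `T` preserves TEA pairs. -/
def PreservesTEAPairs (T : X →L[ℝ] Y) : Prop :=
  ∀ x y : X, IsTEAPair x y → IsTEAPair (T x) (T y)

end

open Filter Topology Metric

section Duality

variable {X : Type*} [NormedAddCommGroup X] [NormedSpace ℝ X]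

/-- A continuous linear functional attains its maximum over a compact set at an extreme point. -/
theorem IsCompact.exists_extremePoint_forall_le {s : Set X} (hs : IsCompact s) (hne : s.Nonempty)
    (l : StrongDual ℝ X) : ∃ x ∈ s.extremePoints ℝ, ∀ y ∈ s, l y ≤ l x := by
  have hexp : IsExposed ℝ s (l.toExposed s) := ContinuousLinearMap.toExposed.isExposed
  obtain ⟨z, hz, hmax⟩ := hs.exists_isMaxOn hne l.continuous.continuousOn
  obtain ⟨x, hx⟩ := (hexp.isCompact hs).extremePoints_nonempty ⟨z, hz, fun y hy => hmax hy⟩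
  exact ⟨x, hexp.isExtreme.extremePoints_subset_extremePoints hx, hx.1.2⟩

theorem StrongDual.apply_le_norm {f : StrongDual ℝ X} (hf : ‖f‖ ≤ 1) (x : X) : f x ≤ ‖x‖ :=
  (le_abs_self _).trans <| (f.le_opNorm x).trans <|
    mul_le_of_le_one_left (norm_nonneg x) hf

theorem StrongDual.norm_eq_one_of_apply_eq_norm {f : StrongDual ℝ X} (hf : ‖f‖ ≤ 1) {x : X}
    (hx : x ≠ 0) (hfx : f x = ‖x‖) : ‖f‖ = 1 := by
  refine hf.antisymm ?_
  have h := (le_abs_self _).trans (f.le_opNorm x)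
  rw [hfx] at h
  exact le_of_mul_le_mul_right (by simpa using h) (norm_pos_iff.2 hx)

theorem norm_le_one_of_mem_dualExt {f : StrongDual ℝ X} (hf : f ∈ dualExt X) : ‖f‖ ≤ 1 := by
  simpa using hf.1

theorem apply_eq_norm_of_apply_add_eq {f : StrongDual ℝ X} (hf : ‖f‖ ≤ 1) {x y : X}
    (h : ‖x‖ + ‖y‖ ≤ f (x + y)) : f x = ‖x‖ ∧ f y = ‖y‖ := by
  have hx := StrongDual.apply_le_norm hf x
  have hy := StrongDual.apply_le_norm hf y
  rw [map_add] at h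
  constructor <;> linarith

theorem isTEAPair_of_apply_eq_norm {f : StrongDual ℝ X} (hf : ‖f‖ ≤ 1) {x y : X}
    (hx : f x = ‖x‖) (hy : f y = ‖y‖) : IsTEAPair x y := by
  refine (norm_add_le x y).antisymm ?_
  rw [← hx, ← hy, ← map_add]
  exact StrongDual.apply_le_norm hf _

theorem norm_eq_one_of_mem_smoothSet {f : StrongDual ℝ X} {x : X} (hx : x ∈ smoothSet f) :
    ‖f‖ = 1 :=
  (hx.2.ge rfl).1

theorem apply_eq_norm_of_mem_smoothSet {f : StrongDual ℝ X} {x : X} (hx : x ∈ smoothSet f) :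
    f x = ‖x‖ :=
  (hx.2.ge rfl).2

theorem eq_of_mem_smoothSet {f g : StrongDual ℝ X} {x : X} (hx : x ∈ smoothSet f)
    (hg : ‖g‖ ≤ 1) (hgx : g x = ‖x‖) : g = f :=
  hx.2.le ⟨StrongDual.norm_eq_one_of_apply_eq_norm hg hx.1 hgx, hgx⟩

theorem mem_smoothSet_of_forall {f : StrongDual ℝ X} (hf : ‖f‖ ≤ 1) {x : X} (hx : x ≠ 0)
    (hfx : f x = ‖x‖) (h : ∀ g : StrongDual ℝ X, ‖g‖ ≤ 1 → g x = ‖x‖ → g = f) :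
    x ∈ smoothSet f := by
  refine ⟨hx, Set.Subset.antisymm (fun g hg => h g hg.1.le hg.2) ?_⟩
  rintro _ rfl
  exact ⟨StrongDual.norm_eq_one_of_apply_eq_norm hf hx hfx, hfx⟩

theorem mem_dualExt_of_mem_smoothSet {f : StrongDual ℝ X} {x : X} (hx : x ∈ smoothSet f) :
    f ∈ dualExt X := by
  refine ⟨by simp [norm_eq_one_of_mem_smoothSet hx], ?_⟩
  rintro g hg h hh ⟨a, b, ha, hb, hab, rfl⟩
  have hg' : ‖g‖ ≤ 1 := by simpa using hg
  have hh' : ‖h‖ ≤ 1 := by simpa using hh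
  refine eq_of_mem_smoothSet hx hg' ((StrongDual.apply_le_norm hg' x).antisymm ?_)
  have h1 := apply_eq_norm_of_mem_smoothSet hx
  have h2 : a * g x + b * h x = ‖x‖ := by simpa using h1
  have h3 := mul_le_mul_of_nonneg_left (StrongDual.apply_le_norm hh' x) hb.le
  have h4 : a * ‖x‖ ≤ a * g x := by
    have : a * ‖x‖ + b * ‖x‖ = ‖x‖ := by rw [← add_mul, hab, one_mul]
    linarith
  exact le_of_mul_le_mul_left h4 ha

/-- The cone over the face of the unit ball supported by `f` is stable under adding smooth points
of that face, and the result is smooth. -/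
theorem add_mem_smoothSet {f : StrongDual ℝ X} {x z : X} (hx : f x = ‖x‖) (hz : z ∈ smoothSet f) :
    x + z ∈ smoothSet f := by
  have hf := (norm_eq_one_of_mem_smoothSet hz).le
  have hfz := apply_eq_norm_of_mem_smoothSet hz
  have hxz : ‖x + z‖ = ‖x‖ + ‖z‖ := isTEAPair_of_apply_eq_norm hf hx hfz
  refine mem_smoothSet_of_forall hf ?_ (by rw [map_add, hxz, hx, hfz]) fun g hg hgx => ?_
  · rw [← norm_pos_iff, hxz]
    exact add_pos_of_nonneg_of_pos (norm_nonneg x) (norm_pos_iff.2 hz.1)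
  · exact eq_of_mem_smoothSet hz hg (apply_eq_norm_of_apply_add_eq hg (hxz ▸ hgx.ge)).2

theorem smul_mem_smoothSet {f : StrongDual ℝ X} {z : X} (hz : z ∈ smoothSet f) {c : ℝ}
    (hc : 0 < c) : c • z ∈ smoothSet f := by
  have hnorm : ‖c • z‖ = c * ‖z‖ := norm_smul_of_nonneg hc.le z
  refine mem_smoothSet_of_forall (norm_eq_one_of_mem_smoothSet hz).le
    (smul_ne_zero hc.ne' hz.1) ?_ fun g hg hgz => ?_
  · rw [hnorm, map_smul, apply_eq_norm_of_mem_smoothSet hz, smul_eq_mul]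
  · rw [hnorm, map_smul, smul_eq_mul] at hgz
    exact eq_of_mem_smoothSet hz hg (mul_left_cancel₀ hc.ne' hgz)

theorem convex_smoothSet (f : StrongDual ℝ X) : Convex ℝ (smoothSet f) := by
  rw [convex_iff_forall_pos]
  intro x hx y hy a b ha hb _
  exact add_mem_smoothSet (apply_eq_norm_of_mem_smoothSet (smul_mem_smoothSet hx ha))
    (smul_mem_smoothSet hy hb)

theorem isClosed_setOf_apply_eq_norm (f : StrongDual ℝ X) : IsClosed {x | f x = ‖x‖} :=
  isClosed_eq f.continuous continuous_norm

/-- A nonzero point near which `f` coincides with the norm is a smooth point supported by `f`. -/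
theorem mem_smoothSet_of_eventually {f : StrongDual ℝ X} (hf : ‖f‖ ≤ 1) {x : X} (hx : x ≠ 0)
    (h : ∀ᶠ y in 𝓝 x, f y = ‖y‖) : x ∈ smoothSet f := by
  refine mem_smoothSet_of_forall hf hx h.self_of_nhds fun g hg hgx => ?_
  have key : ∀ u : X, g u ≤ f u := by
    intro u
    have ht : Tendsto (fun t : ℝ => x + t • u) (𝓝[>] 0) (𝓝 x) := by
      have : Continuous fun t : ℝ => x + t • u := by fun_prop
      simpa using (this.tendsto 0).mono_left nhdsWithin_le_nhds
    obtain ⟨t, ht, htpos⟩ := ((ht.eventually h).and self_mem_nhdsWithin).exists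
    have h1 : g (x + t • u) ≤ f (x + t • u) := ht.symm ▸ StrongDual.apply_le_norm hg _
    have h2 : f x = g x := h.self_of_nhds.trans hgx.symm
    simp only [map_add, map_smul, smul_eq_mul, h2] at h1
    exact le_of_mul_le_mul_left (by linarith) htpos
  ext u
  refine (key u).antisymm ?_
  simpa using key (-u)

variable [FiniteDimensional ℝ X]

theorem exists_mem_dualExt_apply_eq_norm (x : X) : ∃ f ∈ dualExt X, f x = ‖x‖ := by
  have : ProperSpace (StrongDual ℝ X) := FiniteDimensional.proper ℝ _
  obtain ⟨f, hf, hmax⟩ := (isCompact_closedBall (0 : StrongDual ℝ X) 1).exists_extremePoint_forall_le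
    ⟨0, by simp⟩ (NormedSpace.inclusionInDoubleDual ℝ X x)
  refine ⟨f, hf, (StrongDual.apply_le_norm (norm_le_one_of_mem_dualExt hf) x).antisymm ?_⟩
  obtain ⟨g, hg, hgx⟩ := exists_dual_vector'' ℝ x
  have h := hmax g (by simpa using hg)
  simp only [NormedSpace.dual_def] at h
  exact hgx.ge.trans h

/-- The unit ball of the dual is cut out by the extreme points of the unit ball. -/
theorem norm_le_one_of_forall_extremePoints {f : StrongDual ℝ X}
    (h : ∀ v ∈ (closedBall (0 : X) 1).extremePoints ℝ, f v ≤ 1) : ‖f‖ ≤ 1 := by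
  have : ProperSpace X := FiniteDimensional.proper ℝ _
  obtain ⟨v, hv, hmax⟩ := (isCompact_closedBall (0 : X) 1).exists_extremePoint_forall_le
    ⟨0, by simp⟩ f
  have key : ∀ x : X, f x ≤ ‖x‖ := by
    intro x
    rcases eq_or_ne x 0 with rfl | hx
    · simp
    · have h1 := (hmax (‖x‖⁻¹ • x) (by simp [norm_smul, hx])).trans (h v hv)
      rw [map_smul, smul_eq_mul] at h1
      exact (inv_mul_le_one₀ (norm_pos_iff.2 hx)).1 h1
  refine f.opNorm_le_bound zero_le_one fun x => ?_
  rw [one_mul, Real.norm_eq_abs, abs_le']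
  exact ⟨key x, by simpa using key (-x)⟩

end Duality

section Polyhedral

variable {X : Type*} [NormedAddCommGroup X] [NormedSpace ℝ X] [FiniteDimensional ℝ X]

/-- In a polyhedral space, the vertices of the unit ball at which an extreme functional equals `1`
span the space. -/
theorem IsPolyhedral.eq_zero_of_forall_apply_eq_one (hX : IsPolyhedral X) {f : StrongDual ℝ X}
    (hf : f ∈ dualExt X) {u : StrongDual ℝ X}
    (hu : ∀ v ∈ (closedBall (0 : X) 1).extremePoints ℝ, f v = 1 → u v = 0) : u = 0 := by
  have hle : ∀ v ∈ (closedBall (0 : X) 1).extremePoints ℝ, f v ≤ 1 := fun v hv =>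
    (StrongDual.apply_le_norm (norm_le_one_of_mem_dualExt hf) v).trans (by simpa using hv.1)
  have hev : ∀ w : StrongDual ℝ X,
      (∀ v ∈ (closedBall (0 : X) 1).extremePoints ℝ, f v = 1 → w v = 0) →
      ∀ᶠ t : ℝ in 𝓝[>] 0, ‖f + t • w‖ ≤ 1 := by
    intro w hw
    have : ∀ᶠ t : ℝ in 𝓝[>] 0, ∀ v ∈ (closedBall (0 : X) 1).extremePoints ℝ,
        (f + t • w) v ≤ 1 := by
      refine (eventually_all_finite hX).2 fun v hv => ?_
      rcases (hle v hv).eq_or_lt with h1 | h1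
      · exact Eventually.of_forall fun t => by simp [h1, hw v hv h1]
      · have hc : Continuous fun t : ℝ => f v + t * w v := by fun_prop
        have ht : Tendsto (fun t : ℝ => f v + t * w v) (𝓝[>] 0) (𝓝 (f v)) := by
          simpa using (hc.tendsto 0).mono_left nhdsWithin_le_nhds
        filter_upwards [ht.eventually (gt_mem_nhds h1)] with t ht
        simpa using ht.le
    exact this.mono fun t ht => norm_le_one_of_forall_extremePoints ht
  obtain ⟨t, ⟨h1, h2⟩, ht⟩ := (((hev u hu).and (hev (-u) fun v hv h => by
    simp [hu v hv h])).and self_mem_nhdsWithin).exists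
  have h := hf.2 (x₁ := f + t • u) (x₂ := f + t • (-u)) (by simpa using h1) (by simpa using h2)
    ⟨1 / 2, 1 / 2, by norm_num, by norm_num, by norm_num, by module⟩
  simpa [ne_of_gt (show (0 : ℝ) < t from ht)] using h

theorem IsPolyhedral.finite_dualExt (hX : IsPolyhedral X) : (dualExt X).Finite := by
  refine Set.Finite.of_finite_image (f := fun f : StrongDual ℝ X =>
    {v ∈ (closedBall (0 : X) 1).extremePoints ℝ | f v = 1})
    (hX.finite_subsets.subset ?_) fun f hf g _ hfg => ?_
  · rintro _ ⟨f, _, rfl⟩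
    exact Set.sep_subset _ _
  · refine (sub_eq_zero.1 (hX.eq_zero_of_forall_apply_eq_one hf fun v hv h => ?_)).symm
    have : g v = 1 := ((Set.ext_iff.1 hfg v).1 ⟨hv, h⟩).2
    simp [h, this]

/-- Every extreme functional of a nontrivial polyhedral space supports a smooth point. -/
theorem IsPolyhedral.smoothSet_nonempty [Nontrivial X] (hX : IsPolyhedral X) {f : StrongDual ℝ X}
    (hf : f ∈ dualExt X) : (smoothSet f).Nonempty := by
  have hfin : {v ∈ (closedBall (0 : X) 1).extremePoints ℝ | f v = 1}.Finite :=
    hX.subset (Set.sep_subset _ _)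
  set A := hfin.toFinset with hA
  have hmem : ∀ v, v ∈ A ↔ v ∈ (closedBall (0 : X) 1).extremePoints ℝ ∧ f v = 1 := by
    simp [hA]
  have hf1 := norm_le_one_of_mem_dualExt hf
  have hnorm : ∀ v ∈ A, ‖v‖ ≤ 1 := fun v hv => by simpa using ((hmem v).1 hv).1.1
  have hfsum : f (∑ v ∈ A, v) = A.card := by
    rw [map_sum, Finset.sum_congr rfl fun v hv => ((hmem v).1 hv).2]
    simp
  have hsum : ‖∑ v ∈ A, v‖ = A.card := by
    refine le_antisymm ?_ (hfsum ▸ StrongDual.apply_le_norm hf1 _)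
    simpa using norm_sum_le_of_le A hnorm
  have hne : A.Nonempty := by
    rw [Finset.nonempty_iff_ne_empty]
    intro h
    obtain ⟨u, hu⟩ := exists_ne (0 : StrongDual ℝ X)
    refine hu (hX.eq_zero_of_forall_apply_eq_one hf fun v hv hv1 => ?_)
    simpa [h] using (hmem v).2 ⟨hv, hv1⟩
  refine ⟨∑ v ∈ A, v, mem_smoothSet_of_forall hf1 ?_ (hfsum.trans hsum.symm) fun g hg hgx => ?_⟩
  · rw [← norm_pos_iff, hsum]
    exact_mod_cast hne.card_pos
  · have hle : ∀ v ∈ A, g v ≤ 1 := fun v hv =>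
      (StrongDual.apply_le_norm hg v).trans (hnorm v hv)
    have heq : ∑ v ∈ A, g v = ∑ v ∈ A, (1 : ℝ) := by
      rw [← map_sum, hgx, hsum]
      simp
    have hone := (Finset.sum_eq_sum_iff_of_le hle).1 heq
    refine sub_eq_zero.1 (hX.eq_zero_of_forall_apply_eq_one hf fun v hv h => ?_)
    simp [h, hone v ((hmem v).2 ⟨hv, h⟩)]

theorem IsPolyhedral.isOpen_smoothSet (hX : IsPolyhedral X) (f : StrongDual ℝ X) :
    IsOpen (smoothSet f) := by
  rw [isOpen_iff_mem_nhds]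
  intro x hx
  have hlt : ∀ᶠ y in 𝓝 x, ∀ g ∈ dualExt X, g ≠ f → g y < f y := by
    refine (eventually_all_finite hX.finite_dualExt).2 fun g hg => ?_
    by_cases hgf : g = f
    · exact Eventually.of_forall fun y h => absurd hgf h
    · have hgx : g x < f x := by
        rw [apply_eq_norm_of_mem_smoothSet hx]
        refine (StrongDual.apply_le_norm (norm_le_one_of_mem_dualExt hg) x).lt_of_ne fun h => ?_
        exact hgf (eq_of_mem_smoothSet hx (norm_le_one_of_mem_dualExt hg) h)
      exact (g.continuous.continuousAt.eventually_lt f.continuous.continuousAt hgx).mono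
        fun y hy _ => hy
  have heq : ∀ᶠ y in 𝓝 x, f y = ‖y‖ := by
    filter_upwards [hlt] with y hy
    obtain ⟨g, hg, hgy⟩ := exists_mem_dualExt_apply_eq_norm y
    by_cases hgf : g = f
    · exact hgf ▸ hgy
    · have := StrongDual.apply_le_norm (norm_eq_one_of_mem_smoothSet hx).le y
      linarith [hy g hg hgf]
  filter_upwards [heq.eventually_nhds, isOpen_ne.mem_nhds hx.1] with y hy hy0
  exact mem_smoothSet_of_eventually (norm_eq_one_of_mem_smoothSet hx).le hy0 hy

/-- Smooth points are dense in a polyhedral space. -/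
theorem IsPolyhedral.exists_mem_smoothSet (hX : IsPolyhedral X) {W : Set X} (hW : IsOpen W)
    (hne : W.Nonempty) (h0 : (0 : X) ∉ W) : ∃ w ∈ W, ∃ g, w ∈ smoothSet g := by
  have : CompleteSpace X := FiniteDimensional.complete ℝ X
  have : Countable (dualExt X) := hX.finite_dualExt.countable
  have hdense := dense_iUnion_interior_of_closed
    (f := fun g : dualExt X => {x : X | (g : StrongDual ℝ X) x = ‖x‖})
    (fun g => isClosed_setOf_apply_eq_norm _) (by
      refine Set.eq_univ_of_forall fun x => Set.mem_iUnion.2 ?_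
      obtain ⟨g, hg, hgx⟩ := exists_mem_dualExt_apply_eq_norm x
      exact ⟨⟨g, hg⟩, hgx⟩)
  obtain ⟨w, hwW, hw⟩ := hdense.inter_open_nonempty W hW hne
  obtain ⟨⟨g, hg⟩, hwg⟩ := Set.mem_iUnion.1 hw
  exact ⟨w, hwW, g, mem_smoothSet_of_eventually (norm_le_one_of_mem_dualExt hg)
    (fun h => h0 (h ▸ hwW)) (mem_interior_iff_mem_nhds.1 hwg)⟩

/-- An open convex set of pairwise parallel nonzero vectors lies in a single smooth cone. -/
theorem IsPolyhedral.exists_subset_smoothSet (hX : IsPolyhedral X) {W : Set X} (hW : IsOpen W)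
    (hconv : Convex ℝ W) (hne : W.Nonempty) (h0 : (0 : X) ∉ W)
    (hpar : ∀ x ∈ W, ∀ y ∈ W, IsParallelPair x y) : ∃ g ∈ dualExt X, W ⊆ smoothSet g := by
  obtain ⟨w, hw, g, hwg⟩ := hX.exists_mem_smoothSet hW hne h0
  have hg1 := (norm_eq_one_of_mem_smoothSet hwg).le
  have habs : ∀ v ∈ W, |g v| = ‖v‖ := by
    intro v hv
    obtain ⟨c, hc, h⟩ := hpar w hw v hv
    have hcv : ‖c • v‖ = ‖v‖ := by rw [norm_smul, Real.norm_eq_abs, hc, one_mul]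
    obtain ⟨k, hk, hkx⟩ := exists_mem_dualExt_apply_eq_norm (w + c • v)
    have hk1 := norm_le_one_of_mem_dualExt hk
    obtain ⟨h1, h2⟩ := apply_eq_norm_of_apply_add_eq hk1 (by rw [hkx, h, hcv])
    rw [eq_of_mem_smoothSet hwg hk1 h1, map_smul, smul_eq_mul, hcv] at h2
    rw [← abs_norm v, ← h2, abs_mul, hc, one_mul]
  have hpos : ∀ v ∈ W, g v = ‖v‖ := by
    intro v hv
    refine (abs_of_nonneg ?_).symm.trans (habs v hv)
    by_contra! hneg
    have hgw : 0 ≤ g w := apply_eq_norm_of_mem_smoothSet hwg ▸ norm_nonneg w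
    obtain ⟨u, hu, hgu⟩ := hconv.isPreconnected.intermediate_value hv hw
      g.continuous.continuousOn ⟨hneg.le, hgw⟩
    have h := habs u hu
    rw [hgu, abs_zero] at h
    exact h0 (norm_eq_zero.1 h.symm ▸ hu)
  refine ⟨g, mem_dualExt_of_mem_smoothSet hwg, fun v hv => ?_⟩
  exact mem_smoothSet_of_eventually hg1 (fun h => h0 (h ▸ hv))
    (eventually_of_mem (hW.mem_nhds hv) hpos)

end Polyhedral

section Preservers

variable {X Y : Type*} [NormedAddCommGroup X] [NormedSpace ℝ X]
  [NormedAddCommGroup Y] [NormedSpace ℝ Y]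

theorem PreservesTEAPairs.preservesParallelPairs {T : X →L[ℝ] Y} (h : PreservesTEAPairs T) :
    PreservesParallelPairs T := by
  rintro x y ⟨c, hc, hxy⟩
  have h1 : ‖T x + T (c • y)‖ = ‖T x‖ + ‖T (c • y)‖ :=
    h x (c • y) (by rw [IsTEAPair, hxy, norm_smul, Real.norm_eq_abs, hc, one_mul])
  refine ⟨c, hc, ?_⟩
  rw [map_smul] at h1
  rw [h1, norm_smul, Real.norm_eq_abs, hc, one_mul]

theorem apply_map_eq_norm_of_image_smoothSet_subset {T : X →L[ℝ] Y} {f : StrongDual ℝ X}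
    {g : StrongDual ℝ Y} (h : T '' smoothSet f ⊆ smoothSet g) (hne : (smoothSet f).Nonempty)
    {x : X} (hx : f x = ‖x‖) : g (T x) = ‖T x‖ := by
  obtain ⟨z, hz⟩ := hne
  have hc : Continuous fun t : ℝ => x + t • z := by fun_prop
  have ht : Tendsto (fun t : ℝ => x + t • z) (𝓝[>] 0) (𝓝 x) := by
    simpa using (hc.tendsto 0).mono_left nhdsWithin_le_nhds
  refine ((isClosed_setOf_apply_eq_norm g).preimage T.continuous).mem_of_tendsto ht ?_
  filter_upwards [self_mem_nhdsWithin] with t ht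
  exact apply_eq_norm_of_mem_smoothSet
    (h ⟨_, add_mem_smoothSet hx (smul_mem_smoothSet hz ht), rfl⟩)

variable [FiniteDimensional ℝ X]

theorem preservesTEAPairs_of_image_smoothSet_subset (hX : IsPolyhedral X) {T : X →L[ℝ] Y}
    (h : ∀ f ∈ dualExt X, ∃ g ∈ dualExt Y, T '' smoothSet f ⊆ smoothSet g) :
    PreservesTEAPairs T := by
  intro x y hxy
  rcases subsingleton_or_nontrivial X with hs | hs
  · simp [IsTEAPair, Subsingleton.elim x 0, Subsingleton.elim y 0]
  obtain ⟨f, hf, hfxy⟩ := exists_mem_dualExt_apply_eq_norm (x + y)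
  obtain ⟨hfx, hfy⟩ := apply_eq_norm_of_apply_add_eq (norm_le_one_of_mem_dualExt hf)
    (hfxy.trans hxy).ge
  obtain ⟨g, hg, hfg⟩ := h f hf
  have hne := hX.smoothSet_nonempty hf
  exact isTEAPair_of_apply_eq_norm (norm_le_one_of_mem_dualExt hg)
    (apply_map_eq_norm_of_image_smoothSet_subset hfg hne hfx)
    (apply_map_eq_norm_of_image_smoothSet_subset hfg hne hfy)

variable [FiniteDimensional ℝ Y]

theorem PreservesParallelPairs.existsUnique_image_smoothSet_subset (hX : IsPolyhedral X)
    (hY : IsPolyhedral Y) {T : X →L[ℝ] Y} (hT : Function.Bijective T)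
    (h : PreservesParallelPairs T) {f : StrongDual ℝ X} (hf : f ∈ dualExt X) :
    ∃! g : StrongDual ℝ Y, g ∈ dualExt Y ∧ T '' smoothSet f ⊆ smoothSet g := by
  rcases subsingleton_or_nontrivial X with hs | hs
  · have hsY : Subsingleton Y := hT.2.subsingleton
    have hempty : smoothSet f = ∅ :=
      Set.eq_empty_of_forall_notMem fun x hx => hx.1 (Subsingleton.elim x 0)
    obtain ⟨g, hg, -⟩ := exists_mem_dualExt_apply_eq_norm (0 : Y)
    exact ⟨g, ⟨hg, by simp [hempty]⟩, fun k _ => ContinuousLinearMap.ext fun y => by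
      rw [Subsingleton.elim y 0, map_zero, map_zero]⟩
  obtain ⟨z, hz⟩ := hX.smoothSet_nonempty hf
  have hopen : IsOpen (T '' smoothSet f) :=
    T.toLinearMap.isOpenMap_of_finiteDimensional hT.2 _ (hX.isOpen_smoothSet f)
  obtain ⟨g, hg, hsub⟩ := hY.exists_subset_smoothSet hopen
    ((convex_smoothSet f).linear_image T.toLinearMap) ⟨T z, z, hz, rfl⟩
    (by
      rintro ⟨x, hx, hx0⟩
      exact hx.1 (hT.1 (hx0.trans (map_zero T).symm)))
    (by
      rintro _ ⟨x, hx, rfl⟩ _ ⟨y, hy, rfl⟩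
      refine h x y ⟨1, abs_one, ?_⟩
      rw [one_smul]
      exact isTEAPair_of_apply_eq_norm (norm_eq_one_of_mem_smoothSet hx).le
        (apply_eq_norm_of_mem_smoothSet hx) (apply_eq_norm_of_mem_smoothSet hy))
  refine ⟨g, ⟨hg, hsub⟩, fun k hk => ?_⟩
  have hkz := hk.2 ⟨z, hz, rfl⟩
  exact eq_of_mem_smoothSet (hsub ⟨z, hz, rfl⟩) (norm_eq_one_of_mem_smoothSet hkz).le
    (apply_eq_norm_of_mem_smoothSet hkz)

end Preservers

theorem mainTheorem10 {X Y : Type*}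
    [NormedAddCommGroup X] [NormedSpace ℝ X] [FiniteDimensional ℝ X]
    [NormedAddCommGroup Y] [NormedSpace ℝ Y] [FiniteDimensional ℝ Y]
    (hX : IsPolyhedral X) (hY : IsPolyhedral Y)
    (T : X →L[ℝ] Y) (hT : Function.Bijective T) :
    (PreservesParallelPairs T ↔
      ∀ f ∈ dualExt X, ∃! g : StrongDual ℝ Y, g ∈ dualExt Y ∧ T '' smoothSet f ⊆ smoothSet g) ∧
    (PreservesTEAPairs T ↔
      ∀ f ∈ dualExt X, ∃! g : StrongDual ℝ Y, g ∈ dualExt Y ∧ T '' smoothSet f ⊆ smoothSet g) := by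
  have hcone : PreservesParallelPairs T →
      ∀ f ∈ dualExt X, ∃! g : StrongDual ℝ Y, g ∈ dualExt Y ∧ T '' smoothSet f ⊆ smoothSet g :=
    fun h _ hf => h.existsUnique_image_smoothSet_subset hX hY hT hf
  have htea : (∀ f ∈ dualExt X, ∃! g : StrongDual ℝ Y,
      g ∈ dualExt Y ∧ T '' smoothSet f ⊆ smoothSet g) → PreservesTEAPairs T :=
    fun h => preservesTEAPairs_of_image_smoothSet_subset hX fun f hf => (h f hf).exists
  exact ⟨⟨hcone, fun h => (htea h).preservesParallelPairs⟩,
    ⟨fun h => hcone h.preservesParallelPairs, htea⟩⟩
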